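/- All graphs are finite and simple. For a graph $G$ let $\rho(G)$ denote the largest eigenvalue of its adjacency matrix. Let $\nabla$ denote the join of graphs and $\cup$ the disjoint union; $K_m$ is the complete graph on $m$ vertices, and $mK_1$ is the edgeless graph on $m$ vertices. A $[1,b]$-factor of $G$ is a spanning subgraph $H$ of $G$ with $1\le d_H(v)\le b$ for every $v\in V(G)$. A fractional perfect matching of a graph $G$ of order $n$ is a function $f:E(G)\to[0,1]$ such that $\sum_{e\ni v}f(e)\le 1$ for every $v\in V(G)$ and $\sum_{e\in E(G)}f(e)=\frac n2$. For integers $n,b,\delta$ put $$T(n,b,\delta)=K_\delta\,\nabla\,\bigl(K_{n-(b+1)\delta-1}\cup(b\delta+1)K_1\bigr).$$ **Theorem 5.1.** Let $G$ be a connected graph of order $n$ with minimum degree $\delta$. (i) Let $b\ge 2$ be an integer. If $n\ge 4(b+1)\delta+4$ and $\rho(G)\ge\rho(T(n,b,\delta))$, then $G$ contains a $[1,b]$-factor, unless $G\cong T(n,b,\delta)$. (ii) If $n\ge 8\delta+4$ and $\rho(G)\ge\rho(T(n,1,\delta))$, where $T(n,1,\delta)=K_\delta\nabla(K_{n-2\delta-1}\cup(\delta+1)K_1)$,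 then $G$ contains a fractional perfect matching, unless $G\cong T(n,1,\delta)$. -/

import Mathlib

noncomputable section

/-- The spectral radius `ρ(G)`: the largest eigenvalue of the (real symmetric) adjacency matrix
of a finite graph. The set of eigenvalues is finite, and it is nonempty when `V` is nonempty, so
the supremum is then a maximum. -/
def graphSpectralRadius {V : Type*} [Fintype V] (G : SimpleGraph V) : ℝ :=
  open Classical in
  sSup {μ : ℝ | Module.End.HasEigenvalue (Matrix.toLin' (G.adjMatrix ℝ)) μ}

/-- The join `G ∇ H`: the disjoint union of `G` and `H` together with all edges between a vertex
of `G` and a vertex of `H`. -/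
def graphJoin {V W : Type*} (G : SimpleGraph V) (H : SimpleGraph W) : SimpleGraph (V ⊕ W) :=
  (G ⊕g H) ⊔ completeBipartiteGraph V W

/-- The graph `K_δ ∇ (K_{n-(b+1)δ-1} ∪ (bδ+1) K_1)`. It has order `n` as soon as
`(b + 1) * δ + 1 ≤ n`, in which case the natural-number subtraction is the true one. -/
def extremalGraph (n b δ : ℕ) :
    SimpleGraph (Fin δ ⊕ (Fin (n - (b + 1) * δ - 1) ⊕ Fin (b * δ + 1))) :=
  graphJoin (⊤ : SimpleGraph (Fin δ))
    ((⊤ : SimpleGraph (Fin (n - (b + 1) * δ - 1))) ⊕g (⊥ : SimpleGraph (Fin (b * δ + 1))))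

/-- `G` contains an `[a,b]`-factor: a spanning subgraph `H` with `a ≤ d_H(v) ≤ b` for every
vertex `v`. -/
def HasFactor {V : Type*} [Fintype V] (G : SimpleGraph V) (a b : ℕ) : Prop :=
  open Classical in
  ∃ H : SimpleGraph V, H ≤ G ∧ ∀ v : V, a ≤ H.degree v ∧ H.degree v ≤ b

/-- `f` is a fractional matching of `G`: every edge gets a number in `[0,1]`, and at every vertex
the numbers on the incident edges sum to at most `1`. Only the values of `f` on edges of `G`
matter. -/
def IsFractionalMatching {V : Type*} [Fintype V] (G : SimpleGraph V) (f : Sym2 V → ℝ) : Prop :=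
  open Classical in
  (∀ e ∈ G.edgeSet, 0 ≤ f e ∧ f e ≤ 1) ∧ ∀ v : V, ∑ e ∈ G.incidenceFinset v, f e ≤ 1

/-- `G` contains a fractional perfect matching: a fractional matching of total weight `n / 2`,
where `n` is the order of `G`. -/
def HasFractionalPerfectMatching {V : Type*} [Fintype V] (G : SimpleGraph V) : Prop :=
  open Classical in
  ∃ f : Sym2 V → ℝ, IsFractionalMatching G f ∧
    ∑ e ∈ G.edgeFinset, f e = (Fintype.card V : ℝ) / 2

end

/-! Both parts reduce to finding `f : V → V` with `G.Adj v (f v)` and fibres of size at most `b`.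
For `b = 1` such an `f` is a permutation, and half-weights on the edges `s(v, f v)` form a
fractional perfect matching. For `b ≥ 2` its functional graph can be pruned to a `[1,b]`-factor.

If no `f` exists, Hall's theorem gives a set `S` of size `s` and an independent set `I` of size `b *
s + 1` whose neighbours all lie in `S`. So `G` embeds in `T(n,b,s)`, and `s ≥ δ` by the minimum
degree. If `s = δ`, strict monotonicity of `ρ` under adding edges to a connected graph forces `G ≅
T(n,b,δ)`. If `s > δ`, put `l = ρ(T(n,b,δ))`: it is a root of the quotient cubic for `δ`, and
`extremalPoly_lt` makes the cubic for `s` positive at `l`. A test vector constant on the three parts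
then gives `ρ(G) < l`, a contradiction. -/

/-! ### Perron vectors and comparison of spectral radii. -/

open Matrix in
theorem Matrix.IsSymm.exists_nonneg_isMax_eigenvector {V : Type*} [Fintype V] [Nonempty V]
    {A : Matrix V V ℝ} (hA : A.IsSymm) (h0 : ∀ i j, 0 ≤ A i j) :
    ∃ (μ : ℝ) (x : V → ℝ), (∀ v, 0 ≤ x v) ∧ x ≠ 0 ∧ A *ᵥ x = μ • x ∧
      ∀ y : V → ℝ, y ⬝ᵥ A *ᵥ y ≤ μ * (y ⬝ᵥ y) := by
  classical
  set q : EuclideanSpace ℝ V → ℝ := fun y => y.ofLp ⬝ᵥ A *ᵥ y.ofLp with hq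
  have hqc : Continuous q := by
    simp only [hq, dotProduct, mulVec]
    fun_prop
  obtain ⟨x, hx, hmax⟩ := (isCompact_sphere (0 : EuclideanSpace ℝ V) 1).exists_isMaxOn
    (NormedSpace.sphere_nonempty.2 zero_le_one) hqc.continuousOn
  have hnorm : ∀ y : EuclideanSpace ℝ V, ‖y‖ ^ 2 = y.ofLp ⬝ᵥ y.ofLp := by
    intro y
    rw [EuclideanSpace.norm_sq_eq]
    simp [dotProduct, sq]
  have hx1 : x.ofLp ⬝ᵥ x.ofLp = 1 := by
    rw [← hnorm]; simp at hx; simp [hx]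
  have hb : ∀ y : V → ℝ, y ⬝ᵥ A *ᵥ y ≤ q x * (y ⬝ᵥ y) := by
    intro y
    set z : EuclideanSpace ℝ V := WithLp.toLp 2 y with hz
    have hzn : ‖z‖ ^ 2 = y ⬝ᵥ y := hnorm z
    rcases eq_or_ne z 0 with h | h
    · have : y = 0 := by simpa [hz] using h
      simp [this]
    · have hpos : 0 < ‖z‖ := norm_pos_iff.2 h
      have hm := hmax (a := ‖z‖⁻¹ • z) (by simp [norm_smul, hpos.ne'])
      have : q (‖z‖⁻¹ • z) = (‖z‖ ^ 2)⁻¹ * (y ⬝ᵥ A *ᵥ y) := by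
        simp [hq, hz, mulVec_smul, sq, mul_assoc]
      simp only [Set.mem_ofPred_eq, this] at hm
      rw [← hzn]
      rw [inv_mul_le_iff₀ (by positivity)] at hm
      linarith
  -- Since the entries of `A` are nonnegative, taking absolute values cannot lower the Rayleigh
  -- quotient, so `a` is again a maximiser.
  set a : V → ℝ := fun v => |x.ofLp v| with ha
  have haa : a ⬝ᵥ a = 1 := by
    rw [← hx1]; simp [dotProduct, ha]
  have hqa : q x ≤ a ⬝ᵥ A *ᵥ a := by
    simp only [hq, dotProduct, mulVec, Finset.mul_sum]
    refine Finset.sum_le_sum fun i _ => Finset.sum_le_sum fun j _ => ?_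
    have h1 := le_abs_self (x.ofLp i * x.ofLp j)
    rw [abs_mul] at h1
    have h2 := mul_le_mul_of_nonneg_left h1 (h0 i j)
    simp only [ha]
    linarith
  -- A zero of a positive semidefinite form lies in the kernel of its matrix; this makes the
  -- maximiser `a` an eigenvector.
  have hpsd : (q x • (1 : Matrix V V ℝ) - A).PosSemidef := by
    refine Matrix.PosSemidef.of_dotProduct_mulVec_nonneg ?_ ?_
    · unfold Matrix.IsHermitian
      rw [conjTranspose_eq_transpose_of_trivial]
      simp [hA.eq]
    · intro y
      have := hb y
      simp [sub_mulVec, smul_mulVec, dotProduct_sub]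
      linarith
  refine ⟨q x, a, fun v => abs_nonneg _, ?_, ?_, hb⟩
  · rintro h; simp [h] at haa
  · have := (hpsd.dotProduct_mulVec_zero_iff a).1 (by
      have h3 := hb a
      simp only [haa, mul_one] at h3
      simp [sub_mulVec, smul_mulVec, dotProduct_sub, haa]
      linarith)
    rw [sub_mulVec, smul_mulVec, one_mulVec, sub_eq_zero] at this
    exact this.symm

open Classical in
theorem exists_perron {V : Type*} [Fintype V] [Nonempty V] (G : SimpleGraph V) :
    ∃ x : V → ℝ, (∀ v, 0 ≤ x v) ∧ x ≠ 0 ∧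
      (∀ v, ∑ w, (if G.Adj v w then x w else 0) = graphSpectralRadius G * x v) ∧
      ∀ y : V → ℝ, ∑ v, y v * ∑ w, (if G.Adj v w then y w else 0)
        ≤ graphSpectralRadius G * ∑ v, y v * y v := by
  have hmv : ∀ (y : V → ℝ) v, (G.adjMatrix ℝ).mulVec y v
      = ∑ w, (if G.Adj v w then y w else 0) := by
    intro y v
    simp [Matrix.mulVec, dotProduct, SimpleGraph.adjMatrix_apply]
  obtain ⟨μ, x, hx0, hx, hAx, hmax⟩ :=
    (G.isSymm_adjMatrix (α := ℝ)).exists_nonneg_isMax_eigenvector (by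
      intro i j; rw [SimpleGraph.adjMatrix_apply]; split_ifs <;> norm_num)
  have hμ : graphSpectralRadius G = μ := by
    refine IsGreatest.csSup_eq ⟨?_, ?_⟩
    · refine Module.End.hasEigenvalue_of_hasEigenvector (x := x) ⟨?_, hx⟩
      rw [Module.End.mem_eigenspace_iff]
      simpa using hAx
    · rintro ν hν
      obtain ⟨y, hy, hy0⟩ := hν.exists_hasEigenvector
      rw [Module.End.mem_eigenspace_iff] at hy
      have h1 := hmax y
      rw [← Matrix.toLin'_apply, hy, dotProduct_smul, smul_eq_mul] at h1
      have h2 : 0 < y ⬝ᵥ y := by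
        have : 0 ≤ y ⬝ᵥ y := Finset.sum_nonneg fun i _ => mul_self_nonneg _
        exact lt_of_le_of_ne this fun h => hy0 (dotProduct_self_eq_zero.1 h.symm)
      exact le_of_mul_le_mul_right h1 h2
  refine ⟨x, hx0, hx, fun v => ?_, fun y => ?_⟩
  · rw [hμ, ← hmv, hAx]; rfl
  · have := hmax y
    simp only [dotProduct, hmv] at this
    rw [hμ]; exact this

open Classical in
theorem SimpleGraph.Connected.pos_of_eigen {V : Type*} [Fintype V] {G : SimpleGraph V}
    (hG : G.Connected) {x : V → ℝ} (h0 : ∀ v, 0 ≤ x v) (hx : x ≠ 0) {μ : ℝ}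
    (he : ∀ v, ∑ w, (if G.Adj v w then x w else 0) = μ * x v) (v : V) : 0 < x v := by
  by_contra hv
  have hv0 : x v = 0 := le_antisymm (not_lt.1 hv) (h0 v)
  have key : ∀ u w, G.Adj u w → x u = 0 → x w = 0 := by
    intro u w huw hu
    have h1 := he u
    rw [hu, mul_zero, Finset.sum_eq_zero_iff_of_nonneg] at h1
    · simpa [huw] using h1 w (Finset.mem_univ _)
    · intro i _; split_ifs
      exacts [h0 i, le_rfl]
  apply hx
  funext w
  obtain ⟨p⟩ := hG.preconnected v w
  change x w = 0
  induction p with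
  | nil => exact hv0
  | cons h p ih => exact ih (by simp [key _ _ h hv0]) (key _ _ h hv0)

theorem graphSpectralRadius_le_of_iso {V W : Type*} [Fintype V] [Fintype W] [Nonempty V]
    {G : SimpleGraph V} {H : SimpleGraph W} (e : G ≃g H) :
    graphSpectralRadius G ≤ graphSpectralRadius H := by
  classical
  have : Nonempty W := e.toEquiv.symm.nonempty
  obtain ⟨x, -, hx, he, -⟩ := exists_perron G
  obtain ⟨-, -, -, -, hb⟩ := exists_perron H
  have h := hb (fun w => x (e.symm w))
  rw [← e.toEquiv.sum_comp, ← e.toEquiv.sum_comp (fun w => x (e.symm w) * x (e.symm w))] at h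
  have h2 : ∀ v, ∑ w, (if H.Adj (e v) w then x (e.symm w) else 0)
      = graphSpectralRadius G * x v := by
    intro v
    rw [← he, ← e.toEquiv.sum_comp]
    refine Finset.sum_congr rfl fun w _ => ?_
    refine if_congr e.map_adj_iff ?_ rfl
    simp
  simp only [RelIso.coe_fn_toEquiv, h2, RelIso.symm_apply_apply] at h
  have h3 : 0 < ∑ v, x v * x v := by
    obtain ⟨v, hv⟩ := Function.ne_iff.1 hx
    exact Finset.sum_pos' (fun i _ => mul_self_nonneg _) ⟨v, Finset.mem_univ _, by
      have : x v ≠ 0 := hv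
      exact mul_self_pos.2 this⟩
  refine le_of_mul_le_mul_right (le_trans (le_of_eq ?_) h) h3
  rw [Finset.mul_sum]
  exact Finset.sum_congr rfl fun v _ => by ring

/-- The Perron vector of `G` is positive, so in the quadratic form of `H` every extra edge would
contribute strictly. -/
theorem SimpleGraph.Connected.eq_of_le_of_graphSpectralRadius_le {V : Type*} [Fintype V]
    {G H : SimpleGraph V} (hG : G.Connected) (hle : G ≤ H)
    (hρ : graphSpectralRadius H ≤ graphSpectralRadius G) : G = H := by
  classical
  have := hG.nonempty
  obtain ⟨x, hx0, hx, he, -⟩ := exists_perron G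
  obtain ⟨-, -, -, -, hb⟩ := exists_perron H
  have hpos := hG.pos_of_eigen hx0 hx he
  have h1 : ∑ v, x v * ∑ w, (if H.Adj v w then x w else 0)
      ≤ ∑ v, x v * ∑ w, (if G.Adj v w then x w else 0) := by
    refine (hb x).trans ?_
    simp only [he]
    refine (mul_le_mul_of_nonneg_right hρ
      (Finset.sum_nonneg fun v _ => mul_self_nonneg _)).trans (le_of_eq ?_)
    rw [Finset.mul_sum]
    exact Finset.sum_congr rfl fun v _ => by ring
  have hinner : ∀ v w, (if G.Adj v w then x w else 0) ≤ (if H.Adj v w then x w else 0) := by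
    intro v w
    by_cases h : G.Adj v w
    · simp [h, hle h]
    · rw [if_neg h]; split_ifs
      exacts [hx0 w, le_rfl]
  have h2 : ∀ v, x v * ∑ w, (if G.Adj v w then x w else 0)
      ≤ x v * ∑ w, (if H.Adj v w then x w else 0) := fun v =>
    mul_le_mul_of_nonneg_left (Finset.sum_le_sum fun w _ => hinner v w) (hx0 v)
  have h3 := (Finset.sum_eq_sum_iff_of_le fun v _ => h2 v).1
    (le_antisymm (Finset.sum_le_sum fun v _ => h2 v) h1)
  refine le_antisymm hle fun v w hvw => ?_
  have h4 := mul_left_cancel₀ (hpos v).ne' (h3 v (Finset.mem_univ _))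
  have h5 := (Finset.sum_eq_sum_iff_of_le fun w _ => hinner v w).1 h4 w (Finset.mem_univ _)
  by_contra hn
  rw [if_neg hn, if_pos hvw] at h5
  exact (hpos w).ne h5

/-- A positive vector `y` with `A y ≤ l y`, strict somewhere, bounds the spectral radius. -/
theorem SimpleGraph.Connected.graphSpectralRadius_lt {V : Type*} [Fintype V] {G : SimpleGraph V}
    (hG : G.Connected) {y : V → ℝ} (hy : ∀ v, 0 < y v) {l : ℝ}
    (h : open Classical in ∀ v, ∑ w, (if G.Adj v w then y w else 0) ≤ l * y v)
    (h' : open Classical in ∃ v, ∑ w, (if G.Adj v w then y w else 0) < l * y v) :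
    graphSpectralRadius G < l := by
  classical
  have := hG.nonempty
  obtain ⟨x, hx0, hx, he, -⟩ := exists_perron G
  have hpos := hG.pos_of_eigen hx0 hx he
  -- By symmetry of `A`, pairing the hypothesis with the Perron vector `x` gives `ρ ⟨x, y⟩ < l ⟨x,
  -- y⟩`.
  have hswap : ∑ v, x v * ∑ w, (if G.Adj v w then y w else 0)
      = ∑ v, y v * ∑ w, (if G.Adj v w then x w else 0) := by
    simp only [Finset.mul_sum]
    rw [Finset.sum_comm]
    refine Finset.sum_congr rfl fun v _ => Finset.sum_congr rfl fun w _ => ?_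
    simp only [G.adj_comm w v, mul_ite, mul_zero, mul_comm]
  have hlt : ∑ v, x v * ∑ w, (if G.Adj v w then y w else 0) < ∑ v, x v * (l * y v) := by
    obtain ⟨v, hv⟩ := h'
    exact Finset.sum_lt_sum (fun v _ => mul_le_mul_of_nonneg_left (h v) (hx0 v))
      ⟨v, Finset.mem_univ _, mul_lt_mul_of_pos_left hv (hpos v)⟩
  rw [hswap] at hlt
  simp only [he] at hlt
  have e1 : ∑ v, y v * (graphSpectralRadius G * x v)
      = graphSpectralRadius G * ∑ v, x v * y v := by
    rw [Finset.mul_sum]; exact Finset.sum_congr rfl fun v _ => by ring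
  have e2 : ∑ v, x v * (l * y v) = l * ∑ v, x v * y v := by
    rw [Finset.mul_sum]; exact Finset.sum_congr rfl fun v _ => by ring
  rw [e1, e2] at hlt
  exact lt_of_mul_lt_mul_right hlt (Finset.sum_nonneg fun v _ => (mul_pos (hpos v) (hy v)).le)

/-! ### Hall's condition, and factors from a map with small fibres. -/

/-- The Hall condition on the bipartite double cover only needs to be tested on independent
sets. -/
theorem SimpleGraph.exists_map_or_exists_indep {V : Type*} [Fintype V] (G : SimpleGraph V) {b : ℕ}
    (hb : 1 ≤ b) :
    (open Classical in ∃ f : V → V, (∀ v, G.Adj v (f v)) ∧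
      ∀ v, (Finset.univ.filter fun u => f u = v).card ≤ b) ∨
    ∃ B S : Finset V, (∀ u ∈ B, ∀ v ∈ B, ¬ G.Adj u v) ∧
      (∀ v, v ∈ S ↔ ∃ a ∈ B, G.Adj a v) ∧ b * S.card < B.card := by
  classical
  by_cases hB : ∃ B : Finset V, (∀ u ∈ B, ∀ v ∈ B, ¬ G.Adj u v) ∧
      b * (B.biUnion fun v => G.neighborFinset v).card < B.card
  · obtain ⟨B, hind, hcard⟩ := hB
    exact Or.inr ⟨B, _, hind, fun v => by simp, hcard⟩
  left
  push Not at hB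
  have hall := (Finset.all_card_le_biUnion_card_iff_exists_injective
    (fun v => G.neighborFinset v ×ˢ (Finset.univ : Finset (Fin b)))).1 (by
      intro A
      set N := A.biUnion fun v => G.neighborFinset v with hN
      have hmem : ∀ v, v ∈ N ↔ ∃ a ∈ A, G.Adj a v := by simp [hN]
      have e1 : (A.biUnion fun v => G.neighborFinset v ×ˢ (Finset.univ : Finset (Fin b)))
          = N ×ˢ Finset.univ := by
        ext ⟨x, k⟩; simp [hmem]
      rw [e1, Finset.card_product, Finset.card_univ, Fintype.card_fin]
      -- `A \ N` is independent, and its neighbourhood `M` is disjoint from `A ∩ N`. Hence `|A| ≤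
      -- b|M| + |A ∩ N| ≤ b|N|`, the last step using `1 ≤ b`.
      set M := (A \ N).biUnion fun v => G.neighborFinset v with hM
      have hmemM : ∀ v, v ∈ M ↔ ∃ a ∈ A \ N, G.Adj a v := by simp [hM]
      have h1 := hB (A \ N) (by
        intro u hu v hv huv
        exact (Finset.mem_sdiff.1 hv).2 ((hmem v).2 ⟨u, (Finset.mem_sdiff.1 hu).1, huv⟩))
      rw [← hM] at h1
      have h2 : M.card + (A ∩ N).card ≤ N.card := by
        rw [← Finset.card_union_of_disjoint]
        · refine Finset.card_le_card (Finset.union_subset ?_ Finset.inter_subset_right)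
          intro v hv
          obtain ⟨a, ha, hav⟩ := (hmemM v).1 hv
          exact (hmem v).2 ⟨a, (Finset.mem_sdiff.1 ha).1, hav⟩
        · rw [Finset.disjoint_left]
          intro v hv hv'
          obtain ⟨a, ha, hav⟩ := (hmemM v).1 hv
          exact (Finset.mem_sdiff.1 ha).2
            ((hmem a).2 ⟨v, (Finset.mem_inter.1 hv').1, hav.symm⟩)
      have h3 := Finset.card_sdiff_add_card_inter A N
      nlinarith)
  obtain ⟨g, hg, hgm⟩ := hall
  refine ⟨fun v => (g v).1, fun v => by simpa using hgm v, fun v => ?_⟩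
  have : (Finset.univ.filter fun u => (g u).1 = v).card
      ≤ (Finset.univ : Finset (Fin b)).card := by
    refine Finset.card_le_card_of_injOn (fun u => (g u).2) (by simp) ?_
    intro u hu w hw huw
    simp only [Finset.coe_filter, Finset.mem_univ, true_and, Set.mem_ofPred_eq] at hu hw
    exact hg (Prod.ext (hu.trans hw.symm) huw)
  simpa using this

theorem hasFractionalPerfectMatching_of_injective {V : Type*} [Fintype V] {G : SimpleGraph V}
    {f : V → V} (hf : ∀ v, G.Adj v (f v)) (hinj : Function.Injective f) :
    HasFractionalPerfectMatching G := by
  classical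
  have hbij : Function.Bijective f := Finite.injective_iff_bijective.1 hinj
  -- Each arc `v → f v` carries weight `1/2`. A vertex meets only its outgoing arc and its single
  -- incoming one; a 2-cycle puts both on one edge.
  set w : Sym2 V → ℝ := fun e => (∑ v, if s(v, f v) = e then (1 : ℝ) else 0) / 2 with hw
  have hw0 : ∀ e, 0 ≤ w e := fun e => by
    simp only [hw]; exact div_nonneg (Finset.sum_nonneg fun v _ => by split_ifs <;> norm_num)
      (by norm_num)
  have hsum : ∀ E : Finset (Sym2 V), ∑ e ∈ E, w e
      = (∑ v, if s(v, f v) ∈ E then (1 : ℝ) else 0) / 2 := by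
    intro E
    simp only [hw]
    rw [← Finset.sum_div, Finset.sum_comm]
    simp
  have hvert : ∀ v, ∑ e ∈ G.incidenceFinset v, w e ≤ 1 := by
    intro v
    rw [hsum]
    have : (∑ u, if s(u, f u) ∈ G.incidenceFinset v then (1 : ℝ) else 0)
        ≤ ∑ u, ((if u = v then (1 : ℝ) else 0) + if f u = v then 1 else 0) := by
      refine Finset.sum_le_sum fun u _ => ?_
      by_cases h1 : u = v
      · simp only [h1, if_true]; split_ifs <;> norm_num
      by_cases h2 : f u = v
      · simp only [h2, if_true]; split_ifs <;> norm_num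
      rw [if_neg, if_neg h1, if_neg h2]
      · norm_num
      · intro h
        rw [SimpleGraph.mem_incidenceFinset] at h
        have := h.2
        rw [Sym2.mem_iff] at this
        rcases this with h | h
        exacts [h1 h.symm, h2 h.symm]
    rw [Finset.sum_add_distrib] at this
    have h2 : (∑ u, if f u = v then (1 : ℝ) else 0) = 1 := by
      obtain ⟨u, hu⟩ := hbij.2 v
      rw [Finset.sum_eq_single u]
      · simp [hu]
      · intro u' _ hne
        rw [if_neg]; intro h; exact hne (hinj (h.trans hu.symm))
      · simp
    rw [h2] at this
    simp only [Finset.sum_ite_eq', Finset.mem_univ, if_true] at this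
    linarith
  refine ⟨w, ⟨fun e he => ⟨hw0 e, ?_⟩, fun v => ?_⟩, ?_⟩
  · induction e using Sym2.ind with
    | _ a c =>
      refine le_trans ?_ (hvert a)
      refine Finset.single_le_sum (f := w) (fun e _ => hw0 e) ?_
      rw [SimpleGraph.mem_incidenceFinset]
      exact ⟨he, by simp⟩
  · convert hvert v
  · have h := hsum G.edgeFinset
    simp only [SimpleGraph.mem_edgeFinset, SimpleGraph.mem_edgeSet, hf, if_true] at h
    rw [Finset.sum_const, Finset.card_univ, nsmul_eq_mul, mul_one] at h
    convert h

/-- The vertices all of whose children in the functional digraph of `f` have a child which is of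
the same kind again: the least fixed point of "no child is covered by one of its own children". -/
inductive FunLeaf {V : Type*} (f : V → V) : V → Prop
  | mk (v : V) (g : V → V) (hg : ∀ u, f u = v → f (g u) = u)
      (h : ∀ u, f u = v → FunLeaf f (g u)) : FunLeaf f v

/-- If `w` were a child of `v` of the same kind, its child `g w` would again have a child of that
kind, and `g w` comes earlier in the induction. -/
theorem FunLeaf.ne_apply {V : Type*} {f : V → V} {v : V} (hv : FunLeaf f v) :
    ∀ w, FunLeaf f w → f w ≠ v := by
  induction hv with
  | mk v g hg h ih =>
    intro w hw hwv
    obtain ⟨_, g', hg', h'⟩ := hw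
    exact ih w hwv (g' (g w)) (h' _ (hg w hwv)) (hg' _ (hg w hwv))

/-- Vertices split as positions of a game: `L` (all children in `C`), `C` (some child in `L`), and
the undecided `U`. Every vertex of `U` has a child in `U`, so by finiteness `f` permutes `U`. -/
theorem hasFactor_of_fiber_card_le {V : Type*} [Fintype V] {G : SimpleGraph V} {b : ℕ}
    (hb : 2 ≤ b) {f : V → V} (hf : ∀ v, G.Adj v (f v))
    (hfib : open Classical in ∀ v, (Finset.univ.filter fun u => f u = v).card ≤ b) :
    HasFactor G 1 b := by
  classical
  set L : V → Prop := FunLeaf f with hL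
  set C : V → Prop := fun v => ∃ w, FunLeaf f w ∧ f w = v with hC
  set U : V → Prop := fun v => ¬ L v ∧ ¬ C v with hU
  have hLC : ∀ v, L v → ¬ C v := fun v hv ⟨w, hw, hwv⟩ => hv.ne_apply w hw hwv
  have hUpre : ∀ v, U v → ∃ u, U u ∧ f u = v := by
    rintro v ⟨hv, hvC⟩
    have : ∃ u, f u = v ∧ ¬ C u := by
      by_contra hcon
      push Not at hcon
      choose! g hg using hcon
      exact hv ⟨v, g, fun u hu => (hg u hu).2, fun u hu => (hg u hu).1⟩
    obtain ⟨u, hu, huC⟩ := this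
    exact ⟨u, ⟨fun hul => hvC ⟨u, hul, hu⟩, huC⟩, hu⟩
  set SU : Finset V := Finset.univ.filter U with hSU
  have hsub : SU ⊆ SU.image f := by
    intro v hv
    obtain ⟨u, hu, huv⟩ := hUpre v (by simpa [hSU] using hv)
    exact Finset.mem_image.2 ⟨u, by simpa [hSU] using hu, huv⟩
  have himg : SU = SU.image f := Finset.eq_of_subset_of_card_le hsub Finset.card_image_le
  have hinj : Set.InjOn f SU := Finset.card_image_iff.1 (by rw [← himg])
  have hUim : ∀ v, U v → U (f v) := by
    intro v hv
    have : f v ∈ SU := by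
      rw [himg]; exact Finset.mem_image_of_mem f (by simpa [hSU] using hv)
    simpa [hSU] using this
  have hfne : ∀ v, f v ≠ v := fun v h => by
    have := hf v; rw [h] at this; exact G.loopless.irrefl _ this
  -- The arcs leaving `C` are dropped. A vertex of `C` keeps only arcs from children, including one
  -- from `L`; any other vertex keeps its outgoing arc.
  set H : SimpleGraph V :=
    { Adj := fun u v => (¬ C u ∧ f u = v) ∨ (¬ C v ∧ f v = u)
      symm := ⟨fun u v h => h.symm⟩
      loopless := ⟨fun u h => by rcases h with h | h <;> exact hfne u h.2⟩ } with hH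
  have hAdj : ∀ u v, H.Adj u v ↔ (¬ C u ∧ f u = v) ∨ (¬ C v ∧ f v = u) := fun _ _ => Iff.rfl
  refine ⟨H, ?_, fun v => ?_⟩
  · rintro u v (⟨-, rfl⟩ | ⟨-, rfl⟩)
    exacts [hf u, (hf v).symm]
  · have hle : H.degree v ≤ b ∧ 1 ≤ H.degree v := by
      constructor
      · rw [← SimpleGraph.card_neighborFinset_eq_degree]
        by_cases hvC : C v
        · refine le_trans (Finset.card_le_card ?_) (hfib v)
          intro u hu
          rw [SimpleGraph.mem_neighborFinset, hAdj] at hu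
          rcases hu with hu | hu
          · exact absurd hvC hu.1
          · simpa using hu.2
        -- Outside `C`, a surviving child lies in `U`, where `f` is injective. The degree is thus at
        -- most `2`, which is where `2 ≤ b` is needed.
        · have hone : (Finset.univ.filter fun u => ¬ C u ∧ f u = v).card ≤ 1 := by
            rw [Finset.card_le_one]
            have hu' : ∀ u, ¬ C u → f u = v → U u := fun u huC huv =>
              ⟨fun hul => hvC ⟨u, hul, huv⟩, huC⟩
            intro u hu u' hu2
            simp only [Finset.mem_filter, Finset.mem_univ, true_and] at hu hu2
            exact hinj (by simpa [hSU] using hu' u hu.1 hu.2)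
              (by simpa [hSU] using hu' u' hu2.1 hu2.2) (hu.2.trans hu2.2.symm)
          have hsub2 : H.neighborFinset v
              ⊆ {f v} ∪ Finset.univ.filter fun u => ¬ C u ∧ f u = v := by
            intro u hu
            rw [SimpleGraph.mem_neighborFinset, hAdj] at hu
            rcases hu with hu | hu
            · simp [hu.2]
            · simp [hu.1, hu.2]
          have := (Finset.card_le_card hsub2).trans (Finset.card_union_le _ _)
          rw [Finset.card_singleton] at this
          omega
      · rw [Nat.one_le_iff_ne_zero, ← Nat.pos_iff_ne_zero, SimpleGraph.degree_pos_iff_exists_adj]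
        by_cases hvC : C v
        · obtain ⟨w, hw, hwv⟩ := hvC
          exact ⟨w, Or.inr ⟨hLC w hw, hwv⟩⟩
        · exact ⟨f v, Or.inl ⟨hvC, rfl⟩⟩
    refine ⟨?_, ?_⟩
    · convert hle.2
    · convert hle.1

/-! ### The quotient cubic and the spectral comparison. -/

/-- The characteristic polynomial, up to sign, of the quotient matrix of `extremalGraph n b s`. -/
noncomputable def extremalPoly (n b s l : ℝ) : ℝ :=
  l ^ 3 - (n - b * s - 3) * l ^ 2 - (n - b * s - 2) * l
    - (b * s + 1) * s * (l - n + (b + 1) * s + 2)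

theorem extremalPoly_lt {n b s d l : ℝ} (hb : 1 ≤ b) (hd : 1 ≤ d) (hs : d < s)
    (hsn : (b + 1) * s + 1 ≤ n) (hn : 4 * (b + 1) * d + 4 ≤ n) (hl : n - b * d - 2 ≤ l) :
    extremalPoly n b d l < extremalPoly n b s l := by
  have hfac : extremalPoly n b s l - extremalPoly n b d l = (s - d) *
      (b * l * (l + 1) - (b * (s + d) + 1) * (l - n + 2)
        - (b + 1) * (b * (s ^ 2 + s * d + d ^ 2) + s + d)) := by
    unfold extremalPoly; ring
  suffices h : 0 < b * l * (l + 1) - (b * (s + d) + 1) * (l - n + 2)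
        - (b + 1) * (b * (s ^ 2 + s * d + d ^ 2) + s + d) by
    have := mul_pos (sub_pos.2 hs) h
    linarith
  obtain ⟨t, ht, rfl⟩ : ∃ t, 0 ≤ t ∧ l = n - b * d - 2 + t :=
    ⟨l - (n - b * d - 2), by linarith, by ring⟩
  obtain ⟨N, rfl⟩ : ∃ N, n = N + 1 := ⟨n - 1, by ring⟩
  have hbd : d ≤ b * d := le_mul_of_one_le_left (by linarith) hb
  have hs0 : 0 < s := by linarith
  have hd0 : 0 < d := by linarith
  have hb0 : 0 < b := by linarith
  have hbs : b * d ≤ b * s := mul_le_mul_of_nonneg_left hs.le hb0.le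
  have hNs : (b + 1) * s ≤ N := by linarith
  have hNd : 4 * (b + 1) * d + 3 ≤ N := by linarith
  have hN0 : 0 < N := lt_of_lt_of_le (by positivity) hNd
  have h1 : 0 ≤ t * (b * (2 * (N + 1 - b * d - 2) + 1) - b * (s + d) - 1) := by
    refine mul_nonneg ht ?_
    have h2 : 1 ≤ 2 * (N + 1 - b * d - 2) + 1 - (s + d) := by linarith
    have h3 := le_mul_of_one_le_right hb0.le h2
    linarith
  have h3 : 0 ≤ b * t ^ 2 := by positivity
  -- This is the bracket at `t = 0`. The factor `b + 1` groups its `s`-terms into powers of `(b + 1)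
  -- * s`, which `hmono` replaces by the upper bound `N`; what remains splits into `hmain` and
  -- `hconst`.
  have h4 : 0 < (b + 1) * (b * (N - b * d - 1) * (N - b * d) + (b * (s + d) + 1) * (b * d)
      - (b + 1) * (b * (s ^ 2 + s * d + d ^ 2) + s + d)) := by
    have hmono : b * ((b + 1) * s) ^ 2 + (b + 1) * s * (b * d + b + 1)
        ≤ b * N ^ 2 + N * (b * d + b + 1) := by gcongr
    have hmain : 0 < N * (b ^ 2 * N
        - (2 * b ^ 2 * (b + 1) * d + b * (b + 1) + b * d + b + 1)) := by
      refine mul_pos hN0 ?_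
      have e1 : b ^ 2 * (4 * (b + 1) * d + 3) ≤ b ^ 2 * N := by gcongr
      have e2 : b * d ≤ b * (b * d) := le_mul_of_one_le_left (by positivity) hb
      have e3 : b ≤ b * b := le_mul_of_one_le_left hb0.le hb
      have e4 : b * (b * d) ≤ b * (b * (b * d)) := le_mul_of_one_le_left (by positivity) hb
      linarith
    have hconst : 0 ≤ (b + 1) * (b ^ 2 - 1) * (b * d ^ 2 + d) := by
      have : 0 ≤ b ^ 2 - 1 := by linarith [one_le_pow₀ hb (n := 2)]
      positivity
    linarith
  have h5 := (mul_pos_iff_of_pos_left (by linarith)).1 h4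
  linarith

theorem extremalGraph_spectral {n b d : ℕ} (hd : 1 ≤ d) (hn : (b + 1) * d + 1 ≤ n) :
    (n : ℝ) - b * d - 2 ≤ graphSpectralRadius (extremalGraph n b d) ∧
      extremalPoly n b d (graphSpectralRadius (extremalGraph n b d)) = 0 := by
  classical
  set l := graphSpectralRadius (extremalGraph n b d) with hl
  obtain ⟨m, hm⟩ : ∃ m, n - (b + 1) * d - 1 = m := ⟨_, rfl⟩
  have hnm : (n : ℝ) = (b + 1) * d + 1 + m := by
    have : n = (b + 1) * d + 1 + m := by omega
    rw [this]; push_cast; ring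
  obtain ⟨x, hx0, hx, he, -⟩ := exists_perron (extremalGraph n b d)
  rw [← hl] at he
  -- Summing the eigenvalue equations over each part gives the quotient system without first proving
  -- that `x` is constant on parts.
  set a := ∑ i, x (Sum.inl i) with ha
  set r := ∑ i, x (Sum.inr (Sum.inl i)) with hr
  set c := ∑ i, x (Sum.inr (Sum.inr i)) with hc
  have ha0 : 0 ≤ a := Finset.sum_nonneg fun _ _ => hx0 _
  have hr0 : 0 ≤ r := Finset.sum_nonneg fun _ _ => hx0 _
  have hc0 : 0 ≤ c := Finset.sum_nonneg fun _ _ => hx0 _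
  have hexc : ∀ {k : ℕ} (g : Fin k → ℝ) (i : Fin k),
      ∑ j, (if i ≠ j then g j else 0) = ∑ j, g j - g i := by
    intro k g i
    rw [← Finset.sum_filter, ← Finset.sum_erase_eq_sub (Finset.mem_univ i)]
    refine Finset.sum_congr ?_ fun _ _ => rfl
    ext j; simp [eq_comm]
  have e1 : ∀ i, a - x (Sum.inl i) + (r + c) = l * x (Sum.inl i) := by
    intro i
    rw [← he, Fintype.sum_sum_type, Fintype.sum_sum_type, ha, ← hexc (fun j => x (Sum.inl j)) i]
    simp [extremalGraph, graphJoin, hr, hc]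
  have e2 : ∀ i, a + (r - x (Sum.inr (Sum.inl i))) = l * x (Sum.inr (Sum.inl i)) := by
    intro i
    rw [← he, Fintype.sum_sum_type, Fintype.sum_sum_type, hr,
      ← hexc (fun j => x (Sum.inr (Sum.inl j))) i]
    simp [extremalGraph, graphJoin, ha]
  have e3 : ∀ i, a = l * x (Sum.inr (Sum.inr i)) := by
    intro i
    rw [← he, Fintype.sum_sum_type, Fintype.sum_sum_type]
    simp [extremalGraph, graphJoin, ha]
  have f1 : d * (a + r + c) - a = l * a := by
    have := Finset.sum_congr (s₁ := Finset.univ) rfl fun i (_ : i ∈ Finset.univ) => e1 i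
    simp only [Finset.sum_add_distrib, Finset.sum_sub_distrib, ← Finset.mul_sum,
      Finset.sum_const, Finset.card_univ, Fintype.card_fin, nsmul_eq_mul, ← ha] at this
    linarith
  have f2 : m * (a + r) - r = l * r := by
    have := Finset.sum_congr (s₁ := Finset.univ) rfl fun i (_ : i ∈ Finset.univ) => e2 i
    simp only [Finset.sum_add_distrib, Finset.sum_sub_distrib, ← Finset.mul_sum,
      Finset.sum_const, Finset.card_univ, Fintype.card_fin, nsmul_eq_mul, ← hr, hm] at this
    linarith
  have f3 : (b * d + 1) * a = l * c := by
    have := Finset.sum_congr (s₁ := Finset.univ) rfl fun i (_ : i ∈ Finset.univ) => e3 i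
    simp only [← Finset.mul_sum,
      Finset.sum_const, Finset.card_univ, Fintype.card_fin, nsmul_eq_mul, ← hc] at this
    push_cast at this
    linarith
  have hdR : (1 : ℝ) ≤ d := by exact_mod_cast hd
  have hmR : (0 : ℝ) ≤ m := Nat.cast_nonneg m
  have hne : ¬ (a = 0 ∧ r = 0 ∧ c = 0) := by
    rintro ⟨h1, h2, h3⟩
    rw [ha, Finset.sum_eq_zero_iff_of_nonneg fun _ _ => hx0 _] at h1
    rw [hr, Finset.sum_eq_zero_iff_of_nonneg fun _ _ => hx0 _] at h2
    rw [hc, Finset.sum_eq_zero_iff_of_nonneg fun _ _ => hx0 _] at h3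
    apply hx
    funext v
    rcases v with i | i | i
    exacts [h1 i (Finset.mem_univ _), h2 i (Finset.mem_univ _), h3 i (Finset.mem_univ _)]
  have har : 0 < a + r := by
    refine lt_of_le_of_ne (by linarith) fun h => hne ?_
    have h1 : a = 0 := by linarith
    have h2 : r = 0 := by linarith
    refine ⟨h1, h2, ?_⟩
    rw [h1, h2] at f1
    have : (d : ℝ) * c = 0 := by linarith
    rcases mul_eq_zero.1 this with h | h
    · linarith
    · exact h
  -- Adding `f1` and `f2` gives `(m + d - 1) * (a + r) + d * c = l * (a + r)`.
  have hlow : (m : ℝ) + d - 1 ≤ l := by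
    have : ((m : ℝ) + d - 1) * (a + r) ≤ l * (a + r) := by nlinarith
    exact le_of_mul_le_mul_right this har
  have hapos : a ≠ 0 := by
    intro h
    have hr' : r ≠ 0 := fun h' => by rw [h, h'] at har; linarith
    rw [h] at f2
    have : (l - m + 1) * r = 0 := by linarith
    rcases mul_eq_zero.1 this with h | h
    · linarith
    · exact hr' h
  refine ⟨by rw [hnm]; linarith, ?_⟩
  have : extremalPoly n b d l * a = 0 := by
    rw [hnm]; unfold extremalPoly
    linear_combination (-l * (l - m + 1)) * f1 - (d * l) * f2 - (d * (l - m + 1)) * f3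
  exact (mul_eq_zero.1 this).resolve_right hapos

theorem SimpleGraph.Connected.graphSpectralRadius_lt_of_extremalPoly_pos {V : Type*} [Fintype V]
    {G : SimpleGraph V} (hG : G.Connected) {S I : Finset V} {b : ℕ} {l : ℝ} (hS : S.Nonempty)
    (hI : I.card = b * S.card + 1) (hSI : Disjoint S I) (hadj : ∀ v ∈ I, ∀ w, G.Adj v w → w ∈ S)
    (hl0 : 0 < l) (hl : (Fintype.card V : ℝ) - (b + 1) * S.card - 2 < l)
    (hp : 0 < extremalPoly (Fintype.card V) b S.card l) : graphSpectralRadius G < l := by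
  classical
  set s : ℝ := (S.card : ℝ) with hs
  set m : ℝ := (Fintype.card V : ℝ) - (b + 1) * s - 1 with hm
  have hsum : ∀ α β γ : ℝ, ∑ w, (if w ∈ S then α else if w ∈ I then β else γ)
      = s * α + (b * s + 1) * β + m * γ := by
    intro α β γ
    have h1 : ∀ w, (if w ∈ S then α else if w ∈ I then β else γ)
        = (if w ∈ S then α - γ else 0) + (if w ∈ I then β - γ else 0) + γ := by
      intro w
      by_cases h1 : w ∈ S
      · simp [h1, Finset.disjoint_left.1 hSI h1]
      · by_cases h2 : w ∈ I <;> simp [h1, h2]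
    simp only [h1, Finset.sum_add_distrib, Finset.sum_ite_mem, Finset.univ_inter,
      Finset.sum_const, nsmul_eq_mul, Finset.card_univ, hI]
    push_cast
    rw [hm]; ring
  have hk : 0 < l - m + 1 := by rw [hm]; linarith
  have hs0 : 0 < s := by rw [hs]; exact_mod_cast hS.card_pos
  -- The values off `S` solve the eigenvalue equations of `T(n,b,s)` for `l` exactly; all the slack
  -- falls on `S`, where it is at least the cubic over `l * (l - m + 1)`.
  set y : V → ℝ := fun w => if w ∈ S then 1 else if w ∈ I then s / l else s / (l - m + 1) with hy
  have hypos : ∀ w, 0 < y w := by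
    intro w; simp only [hy]; split_ifs <;> positivity
  have hSlt : ∀ v ∈ S, ∑ w, (if G.Adj v w then y w else 0) < l * y v := by
    intro v hv
    have h1 : ∑ w, (if G.Adj v w then y w else 0) ≤ ∑ w, (y w - if w = v then 1 else 0) := by
      refine Finset.sum_le_sum fun w _ => ?_
      by_cases hwv : w = v
      · subst hwv; simp [hy, hv]
      · rw [if_neg hwv, sub_zero]; split_ifs
        exacts [le_rfl, (hypos w).le]
    rw [Finset.sum_sub_distrib, hsum] at h1
    simp only [Finset.sum_ite_eq', Finset.mem_univ, if_true] at h1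
    have hyv : y v = 1 := by simp [hy, hv]
    rw [hyv, mul_one]
    refine lt_of_le_of_lt h1 ?_
    rw [← sub_pos]
    have : l - (s * 1 + (b * s + 1) * (s / l) + m * (s / (l - m + 1)) - 1)
        = extremalPoly (Fintype.card V) b s l / (l * (l - m + 1)) := by
      have hcard : (Fintype.card V : ℝ) = m + (b + 1) * s + 1 := by rw [hm]; ring
      rw [hcard]
      unfold extremalPoly
      field_simp
      ring
    rw [this]; positivity
  refine hG.graphSpectralRadius_lt hypos ?_ ?_
  · intro v
    by_cases hv : v ∈ S
    · exact (hSlt v hv).le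
    by_cases hvI : v ∈ I
    · have h1 : ∑ w, (if G.Adj v w then y w else 0)
          ≤ ∑ w, (if w ∈ S then 1 else if w ∈ I then 0 else 0) := by
        refine Finset.sum_le_sum fun w _ => ?_
        by_cases h : G.Adj v w
        · simp [h, hy, hadj v hvI w h]
        · rw [if_neg h]; split_ifs <;> norm_num
      rw [hsum] at h1
      have hyv : y v = s / l := by simp [hy, hv, hvI]
      rw [hyv, mul_div_cancel₀ _ hl0.ne']
      linarith
    · have hyv : y v = s / (l - m + 1) := by simp [hy, hv, hvI]
      have h1 : ∑ w, (if G.Adj v w then y w else 0)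
          ≤ ∑ w, ((if w ∈ S then 1 else if w ∈ I then 0 else s / (l - m + 1))
            - if w = v then s / (l - m + 1) else 0) := by
        refine Finset.sum_le_sum fun w _ => ?_
        by_cases hwv : w = v
        · subst hwv; simp [hv, hvI]
        rw [if_neg hwv, sub_zero]
        by_cases h : G.Adj v w
        · by_cases hwI : w ∈ I
          · exact absurd (hadj w hwI v h.symm) hv
          · simp [h, hy, hwI]
        · rw [if_neg h]; split_ifs
          exacts [zero_le_one, le_rfl, by positivity]
      rw [Finset.sum_sub_distrib, hsum] at h1
      simp only [Finset.sum_ite_eq', Finset.mem_univ, if_true] at h1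
      refine h1.trans (le_of_eq ?_)
      rw [hyv]
      field_simp
      ring
  · obtain ⟨v, hv⟩ := hS
    exact ⟨v, hSlt v hv⟩

/-! ### Embedding into the extremal graph and conclusion. -/

theorem exists_iso_le_extremalGraph {V : Type*} [Fintype V] {G : SimpleGraph V} {S I : Finset V}
    {b d n : ℕ} (hS : S.card = d) (hI : I.card = b * d + 1) (hSI : Disjoint S I)
    (hadj : ∀ v ∈ I, ∀ w, G.Adj v w → w ∈ S) (hn : Fintype.card V = n) :
    ∃ H, H ≤ extremalGraph n b d ∧ Nonempty (G ≃g H) := by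
  classical
  set W := Fin d ⊕ (Fin (n - (b + 1) * d - 1) ⊕ Fin (b * d + 1))
  set p : V → Fin 3 := fun v => if v ∈ S then 0 else if v ∈ I then 1 else 2 with hp
  set q : W → Fin 3 := Sum.elim (fun _ => 0) (Sum.elim (fun _ => 2) (fun _ => 1)) with hq
  have hp0 : ∀ v, p v = 0 ↔ v ∈ S := by
    intro v; simp only [hp]; split_ifs <;> simp_all
  have hp1 : ∀ v, p v = 1 ↔ v ∈ I := by
    intro v; simp only [hp]
    by_cases h : v ∈ S
    · simp [h, Finset.disjoint_left.1 hSI h]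
    · split_ifs <;> simp_all
  have hp2 : ∀ v, p v = 2 ↔ v ∉ S ∪ I := by
    intro v; simp only [hp]; split_ifs <;> simp_all
  have hcard : ∀ k, Fintype.card {v // p v = k} = Fintype.card {w // q w = k} := by
    have hq' : ∀ k, Fintype.card {w // q w = k} = ∑ w, if q w = k then 1 else 0 := by
      intro k; rw [Fintype.card_subtype, Finset.card_filter]
    intro k
    rw [hq', Fintype.sum_sum_type, Fintype.sum_sum_type, Fintype.card_subtype]
    fin_cases k
    · have : (Finset.univ.filter fun v => p v = 0) = S := by ext v; simp [hp0]
      simp [this, hq, hS]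
    · have : (Finset.univ.filter fun v => p v = 1) = I := by ext v; simp [hp1]
      simp [this, hq, hI]
    · have : (Finset.univ.filter fun v => p v = 2) = (S ∪ I)ᶜ := by
        ext v; simp only [Finset.mem_filter, Finset.mem_univ, true_and, hp2, Finset.mem_compl]
      simp only [Fin.reduceFinMk, this, Finset.card_compl, Finset.card_union_of_disjoint hSI, hS,
        hI, hn]
      simp [hq]
      rw [add_mul, one_mul]
      omega
  -- Any bijection matching the three parts works, since the only non-edges of the extremal graph
  -- lie between an `I`-vertex and a vertex outside `S`.
  let e : V ≃ W := Equiv.ofFiberEquiv (f := p) (g := q) fun k =>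
    Fintype.equivOfCardEq (hcard k)
  have he : ∀ v, q (e v) = p v := fun v => Equiv.ofFiberEquiv_map _ v
  refine ⟨G.map e.toEmbedding, ?_, ⟨SimpleGraph.Iso.map e G⟩⟩
  rw [SimpleGraph.map_le_iff_le_comap]
  intro u v huv
  rw [SimpleGraph.comap_adj]
  have hne : e u ≠ e v := fun h => huv.ne (e.injective h)
  have h1 : q (e u) = 1 → q (e v) = 0 := by
    rw [he, he, hp0, hp1]; exact fun h => hadj u h v huv
  have h2 : q (e v) = 1 → q (e u) = 0 := by
    rw [he, he, hp0, hp1]; exact fun h => hadj v h u huv.symm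
  change (extremalGraph n b d).Adj (e u) (e v)
  generalize e u = x at *
  generalize e v = z at *
  rcases x with x | x | x <;> rcases z with z | z | z <;>
    simp_all [extremalGraph, graphJoin] <;> (rintro rfl; exact hne rfl)

theorem exists_map_or_iso_extremalGraph {V : Type*} [Fintype V] (G : SimpleGraph V)
    [DecidableRel G.Adj] {n δ b : ℕ} (hconn : G.Connected) (hn : Fintype.card V = n)
    (hδ : G.minDegree = δ) (hb : 1 ≤ b) (hnb : 4 * (b + 1) * δ + 4 ≤ n)
    (hρ : graphSpectralRadius (extremalGraph n b δ) ≤ graphSpectralRadius G) :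
    (open Classical in ∃ f : V → V, (∀ v, G.Adj v (f v)) ∧
      ∀ v, (Finset.univ.filter fun u => f u = v).card ≤ b) ∨
    Nonempty (G ≃g extremalGraph n b δ) := by
  classical
  have := hconn.nonempty
  refine (G.exists_map_or_exists_indep hb).imp_right ?_
  rintro ⟨B, S, hind, hmem, hcard⟩
  -- Trimming `B` to this exact size matches the independent part of `T(n,b,s)`; `S` remains the
  -- neighbourhood of all of `B`.
  obtain ⟨I, hIB, hI⟩ : ∃ I ⊆ B, I.card = b * S.card + 1 :=
    Finset.exists_subset_card_eq (Nat.succ_le_of_lt hcard)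
  have hSI : Disjoint S I := by
    rw [Finset.disjoint_left]
    intro v hv hvI
    obtain ⟨a, ha, hav⟩ := (hmem v).1 hv
    exact hind a ha v (hIB hvI) hav
  have hadj : ∀ v ∈ I, ∀ w, G.Adj v w → w ∈ S := fun v hv w h => (hmem w).2 ⟨v, hIB hv, h⟩
  have hδ1 : 1 ≤ δ := by
    have : Nontrivial V := Fintype.one_lt_card_iff_nontrivial.1 (by omega)
    rw [← hδ]
    have h := hconn.preconnected.minDegree_pos_of_nontrivial
    convert Nat.succ_le_of_lt h
  have hδS : δ ≤ S.card := by
    obtain ⟨v, hv⟩ : I.Nonempty := Finset.card_pos.1 (by omega)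
    rw [← hδ]
    refine (G.minDegree_le_degree v).trans ?_
    rw [← SimpleGraph.card_neighborFinset_eq_degree]
    refine Finset.card_le_card fun w hw => hadj v hv w ?_
    simpa using hw
  have hSn : (b + 1) * S.card + 1 ≤ n := by
    have h1 := Finset.card_le_univ (S ∪ I)
    rw [Finset.card_union_of_disjoint hSI, hI, hn] at h1
    nlinarith
  rcases hδS.eq_or_lt with h | h
  · rw [← h] at hI
    obtain ⟨H, hle, ⟨e⟩⟩ := exists_iso_le_extremalGraph h.symm hI hSI hadj hn
    have hH : H = extremalGraph n b δ :=
      (e.connected_iff.1 hconn).eq_of_le_of_graphSpectralRadius_le hle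
        (hρ.trans (graphSpectralRadius_le_of_iso e))
    exact ⟨hH ▸ e⟩
  · exfalso
    obtain ⟨hlow, hzero⟩ := extremalGraph_spectral (n := n) (b := b) hδ1 (by nlinarith)
    have hbR : (1 : ℝ) ≤ b := by exact_mod_cast hb
    have hδR : (1 : ℝ) ≤ δ := by exact_mod_cast hδ1
    have hsR : (δ : ℝ) < S.card := by exact_mod_cast h
    have hnR : 4 * ((b : ℝ) + 1) * δ + 4 ≤ n := by exact_mod_cast hnb
    have hpos := extremalPoly_lt hbR hδR hsR (by exact_mod_cast hSn) hnR hlow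
    rw [hzero] at hpos
    refine absurd hρ (not_le.2 ?_)
    refine hconn.graphSpectralRadius_lt_of_extremalPoly_pos (Finset.card_pos.1 (by omega)) hI hSI
      hadj (by nlinarith) ?_ (by rw [hn]; exact hpos)
    rw [hn]
    nlinarith

theorem theorem5p1 {V : Type*} [Fintype V] (G : SimpleGraph V) [DecidableRel G.Adj] (n δ : ℕ)
    (hconn : G.Connected) (hn : Fintype.card V = n) (hδ : G.minDegree = δ) :
    (∀ b : ℕ, 2 ≤ b → 4 * (b + 1) * δ + 4 ≤ n →
      graphSpectralRadius (extremalGraph n b δ) ≤ graphSpectralRadius G →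
      HasFactor G 1 b ∨ Nonempty (G ≃g extremalGraph n b δ)) ∧
    (8 * δ + 4 ≤ n →
      graphSpectralRadius (extremalGraph n 1 δ) ≤ graphSpectralRadius G →
      HasFractionalPerfectMatching G ∨ Nonempty (G ≃g extremalGraph n 1 δ)) := by
  classical
  refine ⟨fun b hb hnb hρ => ?_, fun hnb hρ => ?_⟩
  · refine (exists_map_or_iso_extremalGraph G hconn hn hδ (by omega) hnb hρ).imp_left ?_
    rintro ⟨f, hf, hfib⟩
    exact hasFactor_of_fiber_card_le hb hf hfib
  · refine (exists_map_or_iso_extremalGraph G hconn hn hδ le_rfl (by omega) hρ).imp_left ?_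
    rintro ⟨f, hf, hfib⟩
    refine hasFractionalPerfectMatching_of_injective hf fun u w huw => ?_
    exact Finset.card_le_one.1 (hfib (f w)) u (by simpa using huw) w (by simp)
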